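/- Let $g\ge 1$ be an integer. \textbf{Times.} For $\mathbf s=(s_1,s_3,\dots,s_{2g-1})\in\mathbb C^g$ put $c_{2g+1}=1$, $c_{2g-1}=0$ and $c_{2\ell-1}(\mathbf s)=\frac{2\ell+1}{2}s_{2\ell+1}$ for $0\le \ell\le g-1$. Let $C(\mathbf s)$ be the lower triangular Toeplitz $g\times g$ matrix with $[C(\mathbf s)]_{i,j}=c_{2g+1-2(i-j)}(\mathbf s)$ for $j\le i$ and $0$ for $i<j$, and let $\mathbf A(\mathbf s)$ be the vector with entries $A_k=\sum_{m=0}^{g+1-k}c_{2m-1}c_{2g-2k-2m+1}$, $1\le k\le g$. Let $(t_{\infty,j})_{1\le j\le 2g+4}$ be irregular times subject to the canonical choice of trivial times ($t_{\infty,2j}=0$ for $1\le j\le g+2$, $t_{\infty,2g+3}=2$, $t_{\infty,2g+1}=0$) and identified with $\mathbf s$ by $t_{\infty,2j+1}=(2j+1)s_{2j+1}$, $0\le j\le g-1$. \textbf{Isomonodromic Hamiltonians.} For $\mathbf q,\mathbf p\in\mathbb C^g$ with $q_1,\dots,q_g$ pairwise distinct and $\boldsymbol\alpha=(\alpha_{\infty,j})\in\mathbb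 C^{2g+4}$ let $\mathrm{Ham}^{(\boldsymbol\alpha)}(\mathbf q,\mathbf p,\mathbf t)=\sum_{k=0}^{g-1}\nu^{(\boldsymbol\alpha)}_{\infty,k+1}(\mathbf t)\,H_{\infty,k}(\mathbf q,\mathbf p,\mathbf t)$, where $$\sum_{k=0}^{g-1}H_{\infty,k}\,q_j^k=p_j^2+P_2(q_j)+\sum_{i\ne j}\frac{p_i-p_j}{q_j-q_i}\qquad(1\le j\le g),$$ $$P_2(\lambda)=-\lambda^{2g+1}-\sum_{k=g+1}^{2g-1}\Big(t_{\infty,2k-2g+1}+\tfrac14\sum_{m=k-g+3}^{g}t_{\infty,2m-1}t_{\infty,2k-2m+5}\Big)\lambda^k-\Big(t_{\infty,1}+\tfrac14\sum_{m=3}^{g}t_{\infty,2m-1}t_{\infty,2g-2m+5}\Big)\lambda^g,$$ and $M\,(\nu^{(\boldsymbol\alpha)}_{\infty,1},\dots,\nu^{(\boldsymbol\alpha)}_{\infty,g})^t=\big(\tfrac{2\alpha_{\infty,2g-1}}{2g-1},\dots,\tfrac{2\alpha_{\infty,1}}{1}\big)^t$, with $M$ the lower triangular Toeplitz $g\times g$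 matrix having $2$ on the diagonal, $0$ on the first subdiagonal and $t_{\infty,2g+3-2d}$ on the $d$-th subdiagonal, $2\le d\le g-1$. Let $\mathbf e_j$ be the $j$-th unit vector of $\mathbb C^{2g+4}$. \textbf{Corrected Hamiltonians.} Let $\tilde I_0(\lambda)=\lambda^{2g+1}+\sum_{k=g}^{2g}\big(\sum_{m=k-g}^{g+1}c_{2m-1}c_{2k-2m+1}\big)\lambda^k$. For pairwise distinct $\lambda_1,\dots,\lambda_g\in\mathbb C$ and $\mu_1,\dots,\mu_g\in\mathbb C$ let $\mathcal A(\lambda)$ be the traceless polynomial $2\times2$ matrix such that $\mathcal A_{1,2}(\lambda)=\beta(\lambda):=\prod_j(\lambda-\lambda_j)$, $\mathcal A_{1,1}$ has degree $<g$ with $\mathcal A_{1,1}(\lambda_j)=\mu_j$, and $h:=-\det\mathcal A$ differs from $\tilde I_0$ by a polynomial of degree $<g$. Its spectral Hamiltonians $H_1,\dots,H_g$ are defined by the expansion at $\lambda=\infty$ of its eigenvalue $\xi=\sqrt h$, $$\xi(\lambda)=\sum_{k=0}^{g+1}c_{2k-1}\lambda^{k-\frac12}+\frac12\sum_{k=1}^gH_k\,\lambda^{-k-\frac12}+O(\lambda^{-g-\frac32}).$$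 Let $\beta_n^{(g)}(\lambda)$ be the polynomial part of $\lambda^{n-g}\beta(\lambda)$, let $(\tilde R_0,\dots,\tilde R_{g-1})^t=C(\mathbf s)^{-1}(\beta_0^{(g)},\dots,\beta_{g-1}^{(g)})^t$, and let $$K_{2k-1}(\boldsymbol\lambda,\boldsymbol\mu;\mathbf s)=H_k-\sum_{j=1}^g\frac{\mu_j\,\tilde R_{k-1}'(\lambda_j)}{\prod_{i\ne j}(\lambda_j-\lambda_i)}\qquad(1\le k\le g).$$ \textbf{Theorem (Identification of the Hamiltonians).} Let $1\le k\le g$. (1) For all $\boldsymbol\lambda,\boldsymbol\mu\in\mathbb C^g$ with $\lambda_1,\dots,\lambda_g$ pairwise distinct, $$(2k-1)\,\mathrm{Ham}^{(\mathbf e_{2k-1})}(\mathbf q=\boldsymbol\lambda,\mathbf p=\boldsymbol\mu,\mathbf t)=K_{2k-1}(\boldsymbol\lambda,\boldsymbol\mu;\mathbf s)+f_{2k-1}(\mathbf s),\qquad f_{2k-1}(\mathbf s)=\big[C(\mathbf s)^{-1}\mathbf A(\mathbf s)\big]_k .$$ (2) $K_{2k-1}$ is the corrected Hamiltonian of the $(2,2g+1)$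 minimal model, expressed in spectral Darboux coordinates. Namely, write $x=s_1$, and let $R_{2\ell-1}[u]$, $\ell\ge0$, be the differential polynomials in $u$ given by $R_{-1}=1$ and $\frac14(\partial_xB)^2+\big((\lambda-u)B-\frac12\partial_x^2B\big)B=\lambda$ for $B(\lambda)=\sum_{\ell\ge0}R_{2\ell-1}[u]\lambda^{-\ell}$. Let $u$ be a holomorphic solution, on an open set of $\mathbb C^g$ containing $\mathbf s$, of the string equation $R_{2g+1}[u]+\sum_{\ell=0}^{g-1}\frac{2\ell+1}2s_{2\ell+1}R_{2\ell-1}[u]=0$ and of the flows $\partial_{s_{2\ell+1}}u=2\partial_xR_{2\ell+1}[u]$, $1\le\ell\le g-1$. Put $A=-\frac12\partial_xB$, $D=-\frac12\partial_x^2B+(\lambda-u)B$, $U=\begin{pmatrix}A&B\\D&-A\end{pmatrix}$, $\mathcal U_{2n+1}=[\lambda^nU]_{\infty,+}-\begin{pmatrix}0&0\\R_{2n+1}[u]&0\end{pmatrix}$, where $[\cdot]_{\infty,+}$ is the polynomial part, and $\mathcal A^{(g)}=\sum_{\ell=1}^{g+1}c_{2\ell-1}(\mathbf s)\,\mathcal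 U_{2\ell-1}$. If at $\mathbf s$ the entry $[\mathcal A^{(g)}]_{1,2}$ has pairwise distinct zeros $\lambda_1,\dots,\lambda_g$ and $\mu_j=[\mathcal A^{(g)}(\lambda_j)]_{1,1}$, then $K_{2k-1}(\boldsymbol\lambda,\boldsymbol\mu;\mathbf s)=H_k-\sum_{j}\mu_j\tilde R_{k-1}'(\lambda_j)/\prod_{i\ne j}(\lambda_j-\lambda_i)$ also with $H_k$ the spectral Hamiltonians of $\mathcal A^{(g)}$ (twice the coefficient of $\lambda^{-k-1/2}$ in its eigenvalue $\xi\sim\lambda^{g+1/2}$) and with $\tilde R_{k-1}(\lambda)=\sum_{j=0}^{k-1}R_{2j-1}[u]\lambda^{k-1-j}$. -/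

import Mathlib

open Polynomial

noncomputable section

namespace PainleveI

/-! Throughout, `g ≥ 1` is the genus and `r_∞ = g + 3`.  The times of the `(2, 2g+1)` minimal model
are `s : Fin g → ℂ`, the entry `s ℓ` being `s_{2ℓ+1}`; the irregular times are `t : ℕ → ℂ`, the entry
`t j` being `t_{∞,j}`, where only `1 ≤ j ≤ 2 r_∞ - 2 = 2g + 4` is meaningful. -/

section Isomonodromic

/-- The canonical choice of trivial times: `t_{∞,2k} = 0` for `1 ≤ k ≤ r_∞ - 1`,
`t_{∞,2r_∞-3} = 2` and `t_{∞,2r_∞-5} = 0`. -/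
structure CanonicalTrivialTimes (g : ℕ) (t : ℕ → ℂ) : Prop where
  even_eq_zero : ∀ k, 1 ≤ k → k ≤ g + 2 → t (2 * k) = 0
  top_eq_two : t (2 * g + 3) = 2
  next_eq_zero : t (2 * g + 1) = 0

/-- The polynomial `P₂(λ)`, whose coefficients are given by the irregular times. -/
def P2 (g : ℕ) (t : ℕ → ℂ) : ℂ[X] :=
  -X ^ (2 * g + 1)
    - ∑ k ∈ Finset.Icc (g + 1) (2 * g - 1),
        C (t (2 * (k - g) + 1)
          + 1 / 4 * ∑ m ∈ Finset.Icc (k - g + 3) g, t (2 * m - 1) * t (2 * k + 5 - 2 * m)) * X ^ k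
    - C (t 1 + 1 / 4 * ∑ m ∈ Finset.Icc 3 g, t (2 * m - 1) * t (2 * g + 5 - 2 * m)) * X ^ g

/-- Right-hand side of the linear system for the `H_{∞,k}`. -/
def hamRhs (g : ℕ) (t : ℕ → ℂ) (q p : Fin g → ℂ) (j : Fin g) : ℂ :=
  p j ^ 2 + (P2 g t).eval (q j) + ∑ i ∈ Finset.univ.erase j, (p i - p j) / (q j - q i)

/-- `(H_{∞,0}, …, H_{∞,g-1})`, the solution of `V_∞ᵗ H = hamRhs`; note that
`Matrix.vandermonde q` has the entries `q i ^ j`, so it is `V_∞ᵗ`. -/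
def HInf (g : ℕ) (t : ℕ → ℂ) (q p : Fin g → ℂ) : Fin g → ℂ :=
  Matrix.mulVec (Matrix.vandermonde q)⁻¹ (hamRhs g t q p)

theorem HInf_spec (g : ℕ) (t : ℕ → ℂ) (q p : Fin g → ℂ) (hq : Function.Injective q) :
    Matrix.mulVec (Matrix.vandermonde q) (HInf g t q p) = hamRhs g t q p := by
  have h : IsUnit (Matrix.vandermonde q).det :=
    isUnit_iff_ne_zero.2 (Matrix.det_vandermonde_ne_zero_iff.2 hq)
  rw [HInf, Matrix.mulVec_mulVec, Matrix.mul_nonsing_inv _ h, Matrix.one_mulVec]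

/-- The lower triangular Toeplitz matrix of the linear system for the `ν_{∞,k}^{(α)}`:
`2` on the diagonal, `0` just below it, then `t_{∞,2g-1}, t_{∞,2g-3}, …, t_{∞,5}`. -/
def nuMatrix (g : ℕ) (t : ℕ → ℂ) : Matrix (Fin g) (Fin g) ℂ := fun i j =>
  if i < j then 0
  else if i = j then 2
  else if (i : ℕ) = j + 1 then 0
  else t (2 * g + 3 - 2 * ((i : ℕ) - j))

/-- `(ν_{∞,1}^{(α)}, …, ν_{∞,g}^{(α)})`, for the deformation vector `α`, where `α j` is `α_{∞,j}`. -/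
def nu (g : ℕ) (t α : ℕ → ℂ) : Fin g → ℂ :=
  Matrix.mulVec (nuMatrix g t)⁻¹
    (fun i => 2 * α (2 * (g - (i : ℕ)) - 1) / ((2 * (g - (i : ℕ)) - 1 : ℕ) : ℂ))

theorem nuMatrix_isUnit_det (g : ℕ) (t : ℕ → ℂ) : IsUnit (nuMatrix g t).det := by
  have h : (nuMatrix g t).det = ∏ i, nuMatrix g t i i :=
    Matrix.det_of_isLowerTriangular _ (fun i j hij => by
      have : i < j := hij
      simp [nuMatrix, this])
  rw [h]
  simp [nuMatrix]

/-- The isomonodromic Hamiltonian `Ham^{(α)}(q, p, t) = ∑ₖ ν_{∞,k+1}^{(α)}(t) H_{∞,k}(q, p, t)`. -/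
def Ham (g : ℕ) (t α : ℕ → ℂ) (q p : Fin g → ℂ) : ℂ :=
  ∑ k, nu g t α k * HInf g t q p k

/-- The direction `e_j` of the tangent space of the base of irregular times. -/
def direction (j : ℕ) : ℕ → ℂ := Pi.single j 1

end Isomonodromic

section Times

/-- `c g s ℓ` is `c_{2ℓ-1}(s)`: it is `1` for `ℓ = g + 1`, it is `0` for `ℓ = g`, and it is
`(2ℓ+1)/2 · s_{2ℓ+1}` for `0 ≤ ℓ ≤ g - 1`. -/
def c (g : ℕ) (s : Fin g → ℂ) (l : ℕ) : ℂ :=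
  if l = g + 1 then 1
  else if h : l < g then (2 * (l : ℂ) + 1) / 2 * s ⟨l, h⟩
  else 0

/-- The lower triangular Toeplitz matrix `C(s)`, with entries `c_{2g+1-2(i-j)}(s)` for `j ≤ i`. -/
def Cmat (g : ℕ) (s : Fin g → ℂ) : Matrix (Fin g) (Fin g) ℂ := fun i j =>
  if i < j then 0 else c g s (g + 1 - ((i : ℕ) - j))

theorem Cmat_isUnit_det (g : ℕ) (s : Fin g → ℂ) : IsUnit (Cmat g s).det := by
  have h : (Cmat g s).det = ∏ i, Cmat g s i i :=
    Matrix.det_of_isLowerTriangular _ (fun i j hij => by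
      have : i < j := hij
      simp [Cmat, this])
  rw [h]
  simp [Cmat, c]

/-- The vector `A(s)`; its `k`-th entry, `1 ≤ k ≤ g`, is
`∑_{m=0}^{g+1-k} c_{2m-1}(s) c_{2g-2k-2m+1}(s)` (here `k` is the index plus one). -/
def Avec (g : ℕ) (s : Fin g → ℂ) (k : Fin g) : ℂ :=
  ∑ m ∈ Finset.range (g - (k : ℕ) + 1), c g s m * c g s (g - (k : ℕ) - m)

/-- `f g s k` is the purely time dependent term `f_{2k'-1}(s) = [C(s)⁻¹ A(s)]_{k'}`, `k' = k + 1`. -/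
def f (g : ℕ) (s : Fin g → ℂ) (k : Fin g) : ℂ :=
  Matrix.mulVec (Cmat g s)⁻¹ (Avec g s) k

/-- The Casimir polynomial `Ĩ₀(λ)`. -/
def casimir (g : ℕ) (s : Fin g → ℂ) : ℂ[X] :=
  X ^ (2 * g + 1)
    + ∑ k ∈ Finset.Icc g (2 * g),
        C (∑ m ∈ Finset.Icc (k - g) (g + 1), c g s m * c g s (k + 1 - m)) * X ^ k

end Times

section Spectral

/-- The coefficients of the formal square root, with constant term `1`, of `∑ bₙ wⁿ`, `b₀ = 1`. -/
def sqrtCoeff (b : ℕ → ℂ) : ℕ → ℂ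
  | 0 => 1
  | n + 1 => (b (n + 1) - ∑ i : Fin n, sqrtCoeff b (i + 1) * sqrtCoeff b (n - i)) / 2
termination_by n => n
decreasing_by all_goals omega

theorem sqrtCoeff_spec (b : ℕ → ℂ) (hb : b 0 = 1) :
    PowerSeries.mk (sqrtCoeff b) ^ 2 = PowerSeries.mk b := by
  ext n
  rw [sq, PowerSeries.coeff_mul, PowerSeries.coeff_mk]
  simp only [PowerSeries.coeff_mk]
  rw [Finset.Nat.sum_antidiagonal_eq_sum_range_succ (fun i j => sqrtCoeff b i * sqrtCoeff b j)]
  cases n with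
  | zero => simp [sqrtCoeff, hb]
  | succ n =>
    rw [Finset.sum_range_succ, Finset.sum_range_succ']
    have h : ∑ i ∈ Finset.range n, sqrtCoeff b (i + 1) * sqrtCoeff b (n + 1 - (i + 1))
        = ∑ i : Fin n, sqrtCoeff b (i + 1) * sqrtCoeff b (n - i) := by
      rw [Finset.sum_range]
      refine Finset.sum_congr rfl fun i _ => ?_
      rw [Nat.add_sub_add_right]
    have h2 : sqrtCoeff b (n + 1)
        = (b (n + 1) - ∑ i : Fin n, sqrtCoeff b (i + 1) * sqrtCoeff b (n - i)) / 2 := by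
      rw [sqrtCoeff]
    have h0 : sqrtCoeff b 0 = 1 := by rw [sqrtCoeff]
    rw [h, Nat.sub_self, Nat.sub_zero, h0, h2]
    ring

/-- The spectral Hamiltonian `H_k`, `k ≥ 1`, of a traceless polynomial matrix `A(λ)` for which
`h := -det A` is monic of degree `2g+1`.  The eigenvalue of `A` with leading term `λ^{g+1/2}` is
`ξ(λ) = √h = λ^{g+1/2} ∑ₙ aₙ λ^{-n}`, with `(∑ₙ aₙ wⁿ)² = w^{2g+1} h(1/w)` and `a₀ = 1`, and `H_k`
is twice its coefficient of `λ^{-k-1/2}`: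
`ξ = ∑_{k=0}^{g+1} c_{2k-1} λ^{k-1/2} + 1/2 ∑_{k=1}^g H_k λ^{-k-1/2} + O(λ^{-g-3/2})`.
This is the normalization for which the spectral invariants are `I = C(s) H` (so `I₁ = H₁`). -/
def spectralHamiltonian (g : ℕ) (A : Matrix (Fin 2) (Fin 2) ℂ[X]) (k : ℕ) : ℂ :=
  2 * sqrtCoeff (fun n => if n ≤ 2 * g + 1 then (-A.det).coeff (2 * g + 1 - n) else 0) (g + 1 + k)

/-- The corrected Hamiltonian `H_{k+1} - ∑ⱼ μⱼ R̃ₖ'(λⱼ) / ∏_{i ≠ j} (λⱼ - λᵢ)` of a Lax matrix `A`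
with spectral Darboux coordinates `(lam, mu)`, for a given polynomial `Rt = R̃ₖ`. -/
def correctedHamiltonian (g : ℕ) (A : Matrix (Fin 2) (Fin 2) ℂ[X]) (Rt : ℂ[X])
    (lam mu : Fin g → ℂ) (k : Fin g) : ℂ :=
  spectralHamiltonian g A (k + 1)
    - ∑ j, mu j * Rt.derivative.eval (lam j) / ∏ i ∈ Finset.univ.erase j, (lam j - lam i)

end Spectral

section PhaseSpace

/-- `β_g(λ) = ∏ⱼ (λ - λⱼ)`. -/
def beta (g : ℕ) (lam : Fin g → ℂ) : ℂ[X] := ∏ j, (X - C (lam j))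

/-- `β_n^{(g)}(λ) = [λ^{n-g} β_g(λ)]_{∞,+}` for `0 ≤ n ≤ g`. -/
def betaTrunc (g : ℕ) (lam : Fin g → ℂ) (n : ℕ) : ℂ[X] := Polynomial.divX^[g - n] (beta g lam)

/-- The polynomials `R̃₀, …, R̃_{g-1}` in the coordinates `(lam; s)`, from the triangular system
`(β_0^{(g)}, …, β_{g-1}^{(g)})ᵗ = C(s) (R̃₀, …, R̃_{g-1})ᵗ`. -/
def Rtilde (g : ℕ) (s lam : Fin g → ℂ) (n : Fin g) : ℂ[X] :=
  ∑ m : Fin g, C ((Cmat g s)⁻¹ n m) * betaTrunc g lam m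

/-- The polynomial `-det 𝒜^{(g)}` in the coordinates `(lam, mu; s)`: the coefficients of
`λ^g, …, λ^{2g+1}` are those of `Ĩ₀`, and the spectral curve `y² = h(λ)` contains the points
`(λⱼ, μⱼ)`. -/
def spectralPoly (g : ℕ) (s lam mu : Fin g → ℂ) : ℂ[X] :=
  casimir g s
    + Lagrange.interpolate Finset.univ lam (fun j => mu j ^ 2 - (casimir g s).eval (lam j))

/-- The Lax matrix `𝒜^{(g)}(λ)` in the spectral Darboux coordinates `(lam, mu; s)`: the traceless
matrix with `(1,2)` entry `∏ⱼ (λ - λⱼ)`, with `(1,1)` entry of degree `< g` and equal to `μⱼ` at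
`λⱼ`, and with `-det = spectralPoly`. -/
def laxMatrix (g : ℕ) (s lam mu : Fin g → ℂ) : Matrix (Fin 2) (Fin 2) ℂ[X] :=
  let a := Lagrange.interpolate Finset.univ lam mu
  !![a, beta g lam;
     (spectralPoly g s lam mu - a ^ 2) /ₘ beta g lam, -a]

/-- Takasaki's corrected Hamiltonian `K_{2k'-1}(λ, μ; s)`, `k' = k + 1`, as a function of the
spectral Darboux coordinates and of the times. -/
def K (g : ℕ) (s lam mu : Fin g → ℂ) (k : Fin g) : ℂ :=
  correctedHamiltonian g (laxMatrix g s lam mu) (Rtilde g s lam k) lam mu k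

end PhaseSpace

section Hierarchy

/-- Differential polynomials in `u`; the variable `X n` stands for `∂ₓⁿ u`. -/
abbrev DiffPoly := MvPolynomial ℕ ℂ

/-- The total derivative `∂ₓ` of differential polynomials. -/
def dx : Derivation ℂ DiffPoly DiffPoly :=
  MvPolynomial.mkDerivation ℂ (fun n => MvPolynomial.X (n + 1))

/-- `R ℓ` is the differential polynomial `R_{2ℓ-1}[u]`; so `R 0 = R_{-1} = 1`, and the recursion is
the coefficient of `λ^{-ℓ}` in `(∂ₓB)²/4 + ((λ - u) B - ∂ₓ²B/2) B = λ`, `B = ∑ R_{2ℓ-1} λ^{-ℓ}`. -/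
def R : ℕ → DiffPoly
  | 0 => 1
  | l + 1 =>
    - MvPolynomial.C (1 / 8) * ∑ i : Fin (l + 1), dx (R i) * dx (R (l - i))
    + MvPolynomial.C (1 / 2) * MvPolynomial.X 0 * ∑ i : Fin (l + 1), R i * R (l - i)
    + MvPolynomial.C (1 / 4) * ∑ i : Fin (l + 1), R (l - i) * dx (dx (R i))
    - MvPolynomial.C (1 / 2) * ∑ i : Fin l, R (i + 1) * R (l - i)
termination_by n => n
decreasing_by all_goals omega

variable (g : ℕ) [NeZero g]

/-- The value at `s` of the differential polynomial `P[u]`, where `x = s₁`. -/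
def evalAt (u : (Fin g → ℂ) → ℂ) (s : Fin g → ℂ) (P : DiffPoly) : ℂ :=
  MvPolynomial.aeval
    (fun n : ℕ => iteratedDeriv n (fun x : ℂ => u (Function.update s 0 x)) (s 0)) P

/-- `u` is a (holomorphic) solution on `Ω` of the `g`-th member of the Painlevé I hierarchy: the
string equation and the KdV flows. -/
structure IsPISolution (Ω : Set (Fin g → ℂ)) (u : (Fin g → ℂ) → ℂ) : Prop where
  isOpen : IsOpen Ω
  analytic : AnalyticOnNhd ℂ u Ω
  string_eq : ∀ s ∈ Ω, evalAt g u s (R (g + 1))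
    + ∑ l : Fin g, (2 * (l : ℂ) + 1) / 2 * s l * evalAt g u s (R l) = 0
  kdv_flow : ∀ s ∈ Ω, ∀ l : Fin g, 1 ≤ (l : ℕ) →
    deriv (fun y : ℂ => u (Function.update s l y)) (s l) = 2 * evalAt g u s (dx (R (l + 1)))

/-- `[λⁿ ∑ₖ aₖ λ^{-k}]_{∞,+} = ∑_{k=0}^n aₖ λ^{n-k}`. -/
def posPart (a : ℕ → ℂ) (n : ℕ) : ℂ[X] := ∑ k ∈ Finset.range (n + 1), C (a k) * X ^ (n - k)

/-- The polynomial `R̃ₙ(λ) = ∑_{k=0}^n R_{2k-1}[u] λ^{n-k}`. -/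
def RtildeU (u : (Fin g → ℂ) → ℂ) (s : Fin g → ℂ) (n : ℕ) : ℂ[X] :=
  posPart (fun k => evalAt g u s (R k)) n

/-- The matrix `𝒰_{2n+1}(λ) = [λⁿ U(λ)]_{∞,+} - R_{2n+1}[u] E_{2,1}`, where `U = (A, B; C, -A)`,
`B = ∑ R_{2k-1} λ^{-k}`, `A = -∂ₓB/2` and `C = -∂ₓ²B/2 + (λ - u) B`; the coefficient of `λ^{-k}` in
`C` is `R_{2k+1} - u R_{2k-1} - ∂ₓ²R_{2k-1}/2` for `k ≥ 0`, and that of `λ` is `1`. -/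
def Umat (u : (Fin g → ℂ) → ℂ) (s : Fin g → ℂ) (n : ℕ) : Matrix (Fin 2) (Fin 2) ℂ[X] :=
  let A := posPart (fun k => -(1 / 2) * evalAt g u s (dx (R k))) n
  !![A, posPart (fun k => evalAt g u s (R k)) n;
     X ^ (n + 1)
        + posPart (fun k => evalAt g u s (R (k + 1)) - u s * evalAt g u s (R k)
            - 1 / 2 * evalAt g u s (dx (dx (R k)))) n
        - C (evalAt g u s (R (n + 1))),
     -A]

/-- The Lax matrix `𝒜^{(g)}(λ) = ∑_{ℓ=1}^{g+1} c_{2ℓ-1}(s) 𝒰_{2ℓ-1}(λ)` of a solution `u`. -/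
def laxMatrixU (u : (Fin g → ℂ) → ℂ) (s : Fin g → ℂ) : Matrix (Fin 2) (Fin 2) ℂ[X] :=
  ∑ n ∈ Finset.range (g + 1), C (c g s (n + 1)) • Umat g u s n

/-- `(lam, mu)` are the spectral Darboux coordinates of a Lax matrix `A`, the zeros of `A₁₂` being
simple: `A₁₂(λⱼ) = 0` and `A₁₁(λⱼ) = μⱼ`, with pairwise distinct `λ₁, …, λ_g`. -/
structure IsSpectralCoord (A : Matrix (Fin 2) (Fin 2) ℂ[X]) (lam mu : Fin g → ℂ) : Prop where
  distinct : Function.Injective lam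
  zero : ∀ j, (A 0 1).eval (lam j) = 0
  value : ∀ j, (A 0 0).eval (lam j) = mu j

end Hierarchy

end PainleveI

end

namespace PainleveI

/-! Part (1). Under the identification of times, `P2` is minus the Casimir polynomial and the matrix
of the `ν`'s is `2C(s)`. Since a Toeplitz matrix is persymmetric, `(2k-1) Ham = ∑ₘ [C⁻¹]ₖₘ
H_{∞,g-m}` (`mul_nu_direction`). The Vandermonde system is solved explicitly (`HInf_eq`): `H_{∞,n}`
is the coefficient `hₙ` of the spectral polynomial minus `∑ⱼ μⱼ (β_{g-n-1}^{(g)})'(λⱼ)/β'(λⱼ)`,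
because the truncations of `β` are the coefficients in `y` of the quotient `(β(λ) - β(y))/(λ - y)`.
Squaring the expansion of `ξ` gives `h_{g-k} = [C H + A]ₖ` (`Cmat_mulVec_spectralHamiltonian`).
Applying `C⁻¹` turns `h` into `H + f` and the truncations of `β` into the `R̃`.

Part (2). In `w = 1/λ` the entries of `𝒜^{(g)}` are truncations of the time series times the
resolvent series, which satisfy `A² + BD = λ`. By the string equation, the truncation errors do not
reach the coefficients of `λ^g` and above in the determinant. So `-det 𝒜^{(g)}` and `spectralPoly`
differ by a polynomial of degree `< g` with `g` distinct zeros (`neg_det_laxMatrixU`). The same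
truncation for the `(1,2)` entry identifies the `R̃` (`betaTrunc_eq`). -/

theorem c_top (g : ℕ) (s : Fin g → ℂ) : c g s (g + 1) = 1 := by simp [c]

theorem c_genus (g : ℕ) (s : Fin g → ℂ) : c g s g = 0 := by simp [c]

theorem c_of_lt {g : ℕ} (s : Fin g → ℂ) {l : ℕ} (h : l < g) :
    c g s l = (2 * (l : ℂ) + 1) / 2 * s ⟨l, h⟩ := by
  have : l ≠ g + 1 := by omega
  simp [c, h, this]

/-- The values of the trivial times are what extends the relation to `l = g` and `l = g + 1`, so
that all later comparisons need no boundary cases. -/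
theorem time_eq_two_mul_c {g : ℕ} {s : Fin g → ℂ} {t : ℕ → ℂ} (ht : CanonicalTrivialTimes g t)
    (hts : ∀ l : Fin g, t (2 * (l : ℕ) + 1) = (2 * (l : ℂ) + 1) * s l) {l : ℕ} (h : l ≤ g + 1) :
    t (2 * l + 1) = 2 * c g s l := by
  rcases Nat.lt_or_ge l g with h1 | h1
  · rw [c_of_lt s h1, hts ⟨l, h1⟩]
    ring
  · obtain rfl | rfl : l = g ∨ l = g + 1 := by omega
    · rw [c_genus, ht.next_eq_zero, mul_zero]
    · rw [c_top, mul_one, ← ht.top_eq_two]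
      congr 1

/-! ### The time series, its square and the Casimir polynomial -/

/-- The series `∑ c_{2(g+1-i)-1} wⁱ`: the polar part `λ^{-g-1/2} ∑ c_{2k-1} λ^{k-1/2}` of the
eigenvalue, in the variable `w = 1/λ`. -/
noncomputable def timeSeries (g : ℕ) (s : Fin g → ℂ) : PowerSeries ℂ :=
  PowerSeries.mk fun i => if i ≤ g + 1 then c g s (g + 1 - i) else 0

theorem coeff_timeSeries_of_le (g : ℕ) (s : Fin g → ℂ) {i : ℕ} (h : i ≤ g + 1) :
    PowerSeries.coeff i (timeSeries g s) = c g s (g + 1 - i) := by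
  simp [timeSeries, h]

theorem coeff_timeSeries_of_lt (g : ℕ) (s : Fin g → ℂ) {i : ℕ} (h : g + 1 < i) :
    PowerSeries.coeff i (timeSeries g s) = 0 := by
  simp [timeSeries, h]

theorem constantCoeff_timeSeries (g : ℕ) (s : Fin g → ℂ) :
    PowerSeries.constantCoeff (timeSeries g s) = 1 := by
  rw [← PowerSeries.coeff_zero_eq_constantCoeff_apply, coeff_timeSeries_of_le g s (Nat.zero_le _),
    Nat.sub_zero, c_top]

theorem coeff_timeSeries_sq_of_le (g : ℕ) (s : Fin g → ℂ) {n : ℕ} (h : n ≤ g + 1) :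
    PowerSeries.coeff n (timeSeries g s ^ 2)
      = ∑ m ∈ Finset.Icc (g + 1 - n) (g + 1), c g s m * c g s (2 * g + 2 - n - m) := by
  rw [sq, PowerSeries.coeff_mul, Finset.Nat.sum_antidiagonal_eq_sum_range_succ_mk]
  refine Finset.sum_bij' (fun i _ => g + 1 - i) (fun m _ => g + 1 - m) ?_ ?_ ?_ ?_ ?_ <;>
    simp only [Finset.mem_range, Finset.mem_Icc]
  · intros; omega
  · intros; omega
  · intros; omega
  · intros; omega
  · intro i hi
    rw [coeff_timeSeries_of_le _ _ (by omega), coeff_timeSeries_of_le _ _ (by omega)]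
    congr 2
    omega

/-- Beyond order `g + 1` only the products with both indices at most `g + 1` survive; this cuts the
convolution down to the range of `Avec`. -/
theorem coeff_timeSeries_sq_Avec (g : ℕ) (s : Fin g → ℂ) (k : Fin g) :
    PowerSeries.coeff (g + 2 + k) (timeSeries g s ^ 2) = Avec g s k := by
  have hk := k.2
  rw [sq, PowerSeries.coeff_mul, Finset.Nat.sum_antidiagonal_eq_sum_range_succ_mk, Avec]
  symm
  refine Finset.sum_of_injOn (fun m => g + 1 - m) ?_ ?_ ?_ ?_
  · intro a ha b hb hab
    simp at *
    omega
  · intro a ha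
    simp at *
    omega
  · intro i hi hi'
    simp only [Finset.mem_range, Finset.coe_range, Set.mem_image, Set.mem_Iio, not_exists,
      not_and] at hi hi'
    by_cases h : g + 1 < i
    · simp only [coeff_timeSeries_of_lt g s h, zero_mul]
    · have : g + 1 < g + 2 + k - i := by
        have := hi' (g + 1 - i)
        omega
      simp only [coeff_timeSeries_of_lt g s this, mul_zero]
  · intro m hm
    simp only [Finset.mem_range] at hm
    simp only
    rw [coeff_timeSeries_of_le _ _ (by omega), coeff_timeSeries_of_le _ _ (by omega)]
    congr 2 <;> omega

theorem natDegree_casimir_le (g : ℕ) (s : Fin g → ℂ) : (casimir g s).natDegree ≤ 2 * g + 1 := by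
  refine natDegree_add_le_of_degree_le (natDegree_X_pow_le _)
    (natDegree_sum_le_of_forall_le _ _ fun k hk => ?_)
  refine (natDegree_C_mul_X_pow_le _ _).trans ?_
  simp at hk
  omega

theorem coeff_casimir (g : ℕ) (s : Fin g → ℂ) {n : ℕ} (h : n ≤ g + 1) :
    (casimir g s).coeff (2 * g + 1 - n) = PowerSeries.coeff n (timeSeries g s ^ 2) := by
  simp only [casimir, coeff_add, coeff_X_pow, finsetSum_coeff, coeff_C_mul]
  rcases Nat.eq_zero_or_pos n with rfl | hn
  · rw [PowerSeries.coeff_zero_eq_constantCoeff_apply, map_pow, constantCoeff_timeSeries]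
    rw [Finset.sum_eq_zero]
    · simp
    · intro k hk
      simp at hk
      rw [if_neg (by omega), mul_zero]
  · rw [if_neg (by omega), coeff_timeSeries_sq_of_le g s h, zero_add,
      Finset.sum_eq_single (2 * g + 1 - n)]
    · rw [if_pos rfl, mul_one]
      refine Finset.sum_congr (congrArg₂ _ (by omega) rfl) fun m hm => ?_
      congr 2
      omega
    · intro b _ hb
      rw [if_neg (Ne.symm hb), mul_zero]
    · intro hb
      simp at hb
      omega

theorem coeff_casimir_of_lt (g : ℕ) (s : Fin g → ℂ) {n : ℕ} (h : n < g) :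
    (casimir g s).coeff n = 0 := by
  simp only [casimir, coeff_add, coeff_X_pow, finsetSum_coeff, coeff_C_mul]
  rw [if_neg (by omega), zero_add]
  refine Finset.sum_eq_zero fun k hk => ?_
  simp at hk
  rw [if_neg (by omega), mul_zero]

/-! ### Spectral invariants from the expansion of the eigenvalue -/

theorem X_pow_dvd_sub_of_dvd_sq_sub_sq {a b : PowerSeries ℂ} {n : ℕ}
    (ha : PowerSeries.constantCoeff a = 1) (hb : PowerSeries.constantCoeff b = 1)
    (h : PowerSeries.X ^ n ∣ a ^ 2 - b ^ 2) : PowerSeries.X ^ n ∣ a - b := by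
  have hu : IsUnit (a + b) := by
    rw [PowerSeries.isUnit_iff_constantCoeff, map_add, ha, hb]
    norm_num
  rw [sq_sub_sq, mul_comm] at h
  exact (hu.dvd_mul_right).1 h

/-- The spectral invariants `h_{g-1}, …, h_0` in terms of the spectral Hamiltonians. -/
theorem Cmat_mulVec_spectralHamiltonian (g : ℕ) (s : Fin g → ℂ) (A : Matrix (Fin 2) (Fin 2) ℂ[X])
    (hA : ∀ n ≤ g + 1,
      (-A.det).coeff (2 * g + 1 - n) = PowerSeries.coeff n (timeSeries g s ^ 2)) :
    (Cmat g s).mulVec (fun k => spectralHamiltonian g A (k + 1)) + Avec g s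
      = fun k : Fin g => (-A.det).coeff (g - 1 - k) := by
  set b : ℕ → ℂ := fun n => if n ≤ 2 * g + 1 then (-A.det).coeff (2 * g + 1 - n) else 0 with hb
  have hb0 : b 0 = 1 := by
    have := hA 0 (Nat.zero_le _)
    rw [PowerSeries.coeff_zero_eq_constantCoeff_apply, map_pow, constantCoeff_timeSeries,
      one_pow] at this
    simpa [hb] using this
  have hsq := sqrtCoeff_spec b hb0
  -- The squares agree to this order, and the sum of the two series has constant term `2`, hence is
  -- a unit.
  have hdvd : PowerSeries.X ^ (g + 2) ∣ PowerSeries.mk (sqrtCoeff b) - timeSeries g s := by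
    refine X_pow_dvd_sub_of_dvd_sq_sub_sq ?_ (constantCoeff_timeSeries g s) ?_
    · rw [← PowerSeries.coeff_zero_eq_constantCoeff_apply, PowerSeries.coeff_mk, sqrtCoeff]
    · rw [hsq, PowerSeries.X_pow_dvd_iff]
      intro m hm
      rw [map_sub, PowerSeries.coeff_mk, ← hA m (by omega), hb]
      simp only
      rw [if_pos (by omega), sub_self]
  obtain ⟨Q, hQ⟩ := hdvd
  have hQc : ∀ k, spectralHamiltonian g A (k + 1) = 2 * PowerSeries.coeff k Q := by
    intro k
    have h1 := congrArg (PowerSeries.coeff (k + (g + 2))) hQ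
    rw [PowerSeries.coeff_X_pow_mul, map_sub, coeff_timeSeries_of_lt g s (by omega),
      PowerSeries.coeff_mk, sub_zero] at h1
    rw [← h1, spectralHamiltonian]
    congr 2
    omega
  funext k
  have hk := k.2
  -- At order `g + 2 + k` the first term gives `Avec`, the cross term gives `C H` (with `H = 2Q`),
  -- and `Q²` enters only from order `2g + 4`.
  have h2 : PowerSeries.mk b = timeSeries g s ^ 2
      + PowerSeries.X ^ (g + 2) * (2 * (timeSeries g s * Q))
      + PowerSeries.X ^ (2 * g + 4) * Q ^ 2 := by
    rw [← hsq, eq_add_of_sub_eq hQ]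
    ring
  have h3 := congrArg (PowerSeries.coeff (g + 2 + k)) h2
  rw [map_add, map_add, coeff_timeSeries_sq_Avec, PowerSeries.coeff_mk, add_comm (g + 2) (k : ℕ),
    PowerSeries.coeff_X_pow_mul, PowerSeries.coeff_X_pow_mul', if_neg (by omega), add_zero, hb]
    at h3
  simp only at h3
  rw [if_pos (by omega), show 2 * g + 1 - (k + (g + 2)) = g - 1 - k by omega] at h3
  rw [h3, Pi.add_apply, add_comm]
  congr 1
  rw [← map_ofNat (PowerSeries.C (R := ℂ)), PowerSeries.coeff_C_mul, mul_comm (timeSeries g s),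
    PowerSeries.coeff_mul, Finset.Nat.sum_antidiagonal_eq_sum_range_succ_mk, Matrix.mulVec,
    dotProduct, Finset.mul_sum]
  simp only [hQc]
  rw [Finset.sum_fin_eq_sum_range]
  symm
  refine Finset.sum_subset_zero_on_sdiff (by simp) ?_ ?_
  · intro j hj
    simp only [Finset.mem_sdiff, Finset.mem_range] at hj
    rw [dif_pos hj.1, Cmat, if_pos (by rw [Fin.lt_def]; simp only; omega), zero_mul]
  · intro j hj
    simp only [Finset.mem_range] at hj
    rw [dif_pos (by omega), Cmat, if_neg (by rw [Fin.lt_def]; simp only; omega),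
      coeff_timeSeries_of_le g s (by omega)]
    ring

/-! ### Dictionary between the irregular times and `s` -/

theorem P2_eq_neg_casimir {g : ℕ} [NeZero g] {s : Fin g → ℂ} {t : ℕ → ℂ}
    (ht : CanonicalTrivialTimes g t)
    (hts : ∀ l : Fin g, t (2 * (l : ℕ) + 1) = (2 * (l : ℂ) + 1) * s l) :
    P2 g t = -casimir g s := by
  have hg := NeZero.pos g
  have key : ∀ k, g ≤ k → k ≤ 2 * g - 1 →
      t (2 * (k - g) + 1)
          + 1 / 4 * ∑ m ∈ Finset.Icc (k - g + 3) g, t (2 * m - 1) * t (2 * k + 5 - 2 * m)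
        = ∑ m ∈ Finset.Icc (k - g) (g + 1), c g s m * c g s (k + 1 - m) := by
    intro k hk1 hk2
    have h1 : ∑ m ∈ Finset.Icc (k - g + 3) g, t (2 * m - 1) * t (2 * k + 5 - 2 * m)
        = 4 * ∑ m ∈ Finset.Ico (k - g + 2) g, c g s m * c g s (k + 1 - m) := by
      rw [Finset.mul_sum]
      refine Finset.sum_bij' (fun i _ => i - 1) (fun m _ => m + 1) ?_ ?_ ?_ ?_ ?_ <;>
        simp only [Finset.mem_Ico, Finset.mem_Icc]
      · intros; omega
      · intros; omega
      · intros; omega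
      · intros; omega
      · intro i hi
        have e1 := time_eq_two_mul_c ht hts (l := i - 1) (by omega)
        have e2 := time_eq_two_mul_c ht hts (l := k + 1 - (i - 1)) (by omega)
        rw [show 2 * i - 1 = 2 * (i - 1) + 1 by omega,
          show 2 * k + 5 - 2 * i = 2 * (k + 1 - (i - 1)) + 1 by omega, e1, e2]
        ring
    -- The two extreme terms contain `c_{2g+1} = 1` and together give the linear term
    -- `t_{∞,2(k-g)+1}`; the terms containing `c_{2g-1} = 0` drop out here and in `h3`.
    have h2 : ∑ m ∈ Finset.Icc (k - g) (g + 1), c g s m * c g s (k + 1 - m)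
        = c g s (k - g) + ∑ m ∈ Finset.Ico (k - g + 1) g, c g s m * c g s (k + 1 - m)
          + c g s (k - g) := by
      rw [← Finset.Ico_add_one_right_eq_Icc, Finset.sum_Ico_succ_top (by omega),
        Finset.sum_Ico_succ_top (by omega), Finset.sum_eq_sum_Ico_succ_bot (by omega),
        c_top, c_genus, show k + 1 - (k - g) = g + 1 by omega,
        show k + 1 - (g + 1) = k - g by omega, c_top]
      ring
    have h3 : ∑ m ∈ Finset.Ico (k - g + 1) g, c g s m * c g s (k + 1 - m)
        = ∑ m ∈ Finset.Ico (k - g + 2) g, c g s m * c g s (k + 1 - m) := by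
      rcases Nat.lt_or_ge (k - g + 1) g with h | h
      · rw [Finset.sum_eq_sum_Ico_succ_bot h, show k + 1 - (k - g + 1) = g by omega, c_genus]
        ring
      · rw [Finset.Ico_eq_empty (by omega), Finset.Ico_eq_empty (by omega)]
    rw [h1, h2, h3, time_eq_two_mul_c ht hts (by omega)]
    ring
  have htop : ∑ m ∈ Finset.Icc (2 * g - g) (g + 1), c g s m * c g s (2 * g + 1 - m) = 0 := by
    rw [← Finset.Ico_add_one_right_eq_Icc, Finset.sum_Ico_succ_top (by omega),
      show 2 * g - g = g by omega, show 2 * g + 1 - (g + 1) = g by omega, c_genus]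
    simp [c_genus]
  rw [P2, casimir, ← Finset.Ico_add_one_right_eq_Icc g, Finset.sum_Ico_succ_top (by omega), htop,
    Finset.sum_eq_sum_Ico_succ_bot (by omega), ← key g le_rfl (by omega),
    ← Finset.Ico_add_one_right_eq_Icc (g + 1), show 2 * g - 1 + 1 = 2 * g by omega,
    Finset.sum_congr rfl (fun k hk => by
      rw [key k (by simp at hk; omega) (by simp at hk; omega)])]
  simp only [Nat.sub_self, mul_zero, zero_add, map_zero, zero_mul, add_zero]
  ring

/-- Reversing both indices transposes a Toeplitz matrix, and this symmetry passes to the inverse. -/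
theorem Cmat_inv_rev (g : ℕ) (s : Fin g → ℂ) (i j : Fin g) :
    (Cmat g s)⁻¹ i.rev j.rev = (Cmat g s)⁻¹ j i := by
  have h : (Cmat g s).submatrix Fin.revPerm Fin.revPerm = (Cmat g s).transpose := by
    ext i j
    simp only [Matrix.submatrix_apply, Fin.revPerm_apply, Matrix.transpose_apply, Cmat,
      Fin.rev_lt_rev, Fin.val_rev]
    split_ifs
    · rfl
    · congr 1
      omega
  have h2 := congrArg (fun M => M⁻¹ i j) h
  simp only [Matrix.inv_submatrix_equiv, ← Matrix.transpose_nonsing_inv] at h2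
  exact h2

theorem nuMatrix_eq {g : ℕ} {s : Fin g → ℂ} {t : ℕ → ℂ} (ht : CanonicalTrivialTimes g t)
    (hts : ∀ l : Fin g, t (2 * (l : ℕ) + 1) = (2 * (l : ℂ) + 1) * s l) :
    nuMatrix g t = (2 : ℂ) • Cmat g s := by
  ext i j
  simp only [nuMatrix, Matrix.smul_apply, Cmat, smul_eq_mul]
  split_ifs with h1 h2 h3
  · simp
  · subst h2
    simp [c_top]
  · simp [h3, c_genus]
  · have h4 : g + 1 - ((i : ℕ) - j) ≤ g + 1 := by omega
    rw [← time_eq_two_mul_c ht hts h4]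
    congr 1
    have := i.2
    omega

theorem mul_nu_direction {g : ℕ} {s : Fin g → ℂ} {t : ℕ → ℂ} (ht : CanonicalTrivialTimes g t)
    (hts : ∀ l : Fin g, t (2 * (l : ℕ) + 1) = (2 * (l : ℂ) + 1) * s l) (k n : Fin g) :
    (2 * (k : ℂ) + 1) * nu g t (direction (2 * (k : ℕ) + 1)) n = (Cmat g s)⁻¹ k n.rev := by
  have h0 : (2 * (k : ℂ) + 1) ≠ 0 := by exact_mod_cast Nat.succ_ne_zero (2 * (k : ℕ))
  -- The right-hand side lists the times downwards, so the direction `2k + 1` sits at position `g -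
  -- 1 - k`.
  have hv : (fun i : Fin g => 2 * direction (2 * (k : ℕ) + 1) (2 * (g - (i : ℕ)) - 1)
      / ((2 * (g - (i : ℕ)) - 1 : ℕ) : ℂ)) = Pi.single k.rev (2 / (2 * (k : ℂ) + 1)) := by
    funext i
    by_cases h : i = k.rev
    · subst h
      have : 2 * (g - (k.rev : ℕ)) - 1 = 2 * (k : ℕ) + 1 := by
        rw [Fin.val_rev]
        omega
      rw [this]
      simp [direction]
    · have : 2 * (g - (i : ℕ)) - 1 ≠ 2 * (k : ℕ) + 1 := by
        intro h'
        apply h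
        ext
        rw [Fin.val_rev]
        omega
      simp [direction, h, this]
  rw [nu, hv, nuMatrix_eq ht hts, Matrix.mulVec_single]
  have hinv : ((2 : ℂ) • Cmat g s)⁻¹ = (2 : ℂ)⁻¹ • (Cmat g s)⁻¹ := by
    refine Matrix.inv_eq_right_inv ?_
    rw [smul_mul_smul_comm, Matrix.mul_nonsing_inv _ (Cmat_isUnit_det g s)]
    norm_num
  rw [hinv, ← Cmat_inv_rev g s n.rev k, Fin.rev_rev]
  simp [Matrix.col]
  field_simp

/-! ### The Lax matrix and the Vandermonde system in spectral Darboux coordinates -/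

section Lax

variable {g : ℕ} {lam : Fin g → ℂ}

theorem monic_beta (g : ℕ) (lam : Fin g → ℂ) : (beta g lam).Monic :=
  monic_prod_of_monic _ _ fun i _ => monic_X_sub_C (lam i)

theorem natDegree_beta (g : ℕ) (lam : Fin g → ℂ) : (beta g lam).natDegree = g := by
  rw [beta, natDegree_prod_of_monic _ _ fun i _ => monic_X_sub_C (lam i)]
  simp

theorem eval_beta (g : ℕ) (lam : Fin g → ℂ) (j : Fin g) : (beta g lam).eval (lam j) = 0 := by
  rw [beta, eval_prod]
  exact Finset.prod_eq_zero (Finset.mem_univ j) (by simp)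

theorem beta_dvd_of_eval_eq_zero (hl : Function.Injective lam) {p : ℂ[X]}
    (h : ∀ j, p.eval (lam j) = 0) : beta g lam ∣ p := by
  refine Finset.prod_dvd_of_coprime ?_ fun j _ => dvd_iff_isRoot.2 (h j)
  intro i _ j _ hij
  exact isCoprime_X_sub_C_of_isUnit_sub (sub_ne_zero.2 (hl.ne hij)).isUnit

theorem eval_interpolate_node (hl : Function.Injective lam) (r : Fin g → ℂ) (j : Fin g) :
    (Lagrange.interpolate Finset.univ lam r).eval (lam j) = r j :=
  Lagrange.eval_interpolate_at_node r hl.injOn (Finset.mem_univ j)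

theorem degree_interpolate_lt_genus (hl : Function.Injective lam) (r : Fin g → ℂ) :
    (Lagrange.interpolate Finset.univ lam r).degree < g := by
  simpa using Lagrange.degree_interpolate_lt (s := Finset.univ) r hl.injOn

theorem eval_spectralPoly (s mu : Fin g → ℂ) (hl : Function.Injective lam) (j : Fin g) :
    (spectralPoly g s lam mu).eval (lam j) = mu j ^ 2 := by
  rw [spectralPoly, eval_add, eval_interpolate_node hl]
  ring

theorem neg_det_laxMatrix (s mu : Fin g → ℂ) (hl : Function.Injective lam) :
    -(laxMatrix g s lam mu).det = spectralPoly g s lam mu := by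
  -- The division defining the `(2,1)` entry is exact, since `h = μⱼ²` at each simple zero `λⱼ` of
  -- `β`.
  have hdvd : beta g lam ∣ spectralPoly g s lam mu - Lagrange.interpolate Finset.univ lam mu ^ 2 :=
    beta_dvd_of_eval_eq_zero hl fun j => by
      rw [eval_sub, eval_spectralPoly s mu hl, eval_pow, eval_interpolate_node hl, sub_self]
  have h := (modByMonic_eq_zero_iff_dvd (monic_beta g lam)).2 hdvd
  have h2 := modByMonic_add_div (spectralPoly g s lam mu
    - Lagrange.interpolate Finset.univ lam mu ^ 2) (beta g lam)
  rw [h, zero_add] at h2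
  rw [laxMatrix, Matrix.det_fin_two_of, h2]
  ring

theorem coeff_spectralPoly (s mu : Fin g → ℂ) (hl : Function.Injective lam) {n : ℕ}
    (h : n ≤ g + 1) :
    (spectralPoly g s lam mu).coeff (2 * g + 1 - n)
      = PowerSeries.coeff n (timeSeries g s ^ 2) := by
  rw [spectralPoly, coeff_add, coeff_casimir g s h,
    coeff_eq_zero_of_degree_lt ((degree_interpolate_lt_genus hl _).trans_le _), add_zero]
  exact_mod_cast (by omega : g ≤ 2 * g + 1 - n)

/-- Synthetic division by `X - y`, stopped after `N` steps; the induction telescopes through `p = X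
· divX p + p(0)`. -/
theorem X_sub_C_mul_sum_divX (p : ℂ[X]) (y : ℂ) (N : ℕ) :
    (X - C y) * ∑ n ∈ Finset.range N, C (y ^ n) * divX^[n + 1] p
      = p - C (y ^ N) * divX^[N] p - C (∑ n ∈ Finset.range N, (divX^[n] p).coeff 0 * y ^ n) := by
  induction N with
  | zero => simp
  | succ N ih =>
    have h := divX_mul_X_add (divX^[N] p)
    rw [← Function.iterate_succ_apply' divX] at h
    rw [Finset.sum_range_succ, Finset.sum_range_succ, mul_add, ih, map_add, map_mul, pow_succ,
      map_mul]
    linear_combination C (y ^ N) * h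

theorem coeff_iterate_divX (p : ℂ[X]) (n m : ℕ) : (divX^[n] p).coeff m = p.coeff (m + n) := by
  induction n generalizing m with
  | zero => rfl
  | succ n ih => rw [Function.iterate_succ_apply', coeff_divX, ih]; congr 1; omega

/-- At a root the remainder of the synthetic division vanishes. This generating function lets a row
of the Vandermonde matrix act on the truncations of `β`. -/
theorem sum_divX_beta (lam : Fin g → ℂ) (i : Fin g) :
    ∑ n ∈ Finset.range g, C (lam i ^ n) * divX^[n + 1] (beta g lam)
      = ∏ l ∈ Finset.univ.erase i, (X - C (lam l)) := by
  have hg : divX^[g] (beta g lam) = C ((beta g lam).coeff g) := by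
    ext m
    rw [coeff_iterate_divX, coeff_C]
    split_ifs with h
    · rw [h, zero_add]
    · exact coeff_eq_zero_of_natDegree_lt (by rw [natDegree_beta]; omega)
  have h := X_sub_C_mul_sum_divX (beta g lam) (lam i) g
  have h0 := eval_beta g lam i
  rw [eval_eq_sum_range, natDegree_beta, Finset.sum_range_succ] at h0
  simp only [coeff_iterate_divX, zero_add] at h
  rw [hg, ← map_mul, sub_sub, ← map_add, mul_comm (lam i ^ g), add_comm, h0, map_zero, sub_zero] at h
  refine mul_left_cancel₀ (X_sub_C_ne_zero (lam i)) (h.trans ?_)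
  exact (Finset.mul_prod_erase _ _ (Finset.mem_univ i)).symm

/-- For `j = i` this is a logarithmic derivative; otherwise only the term of the product rule that
removes the factor `X - λⱼ` survives. -/
theorem eval_derivative_prod_erase (hl : Function.Injective lam) (i j : Fin g) :
    (derivative (∏ l ∈ Finset.univ.erase i, (X - C (lam l)))).eval (lam j)
        / ∏ l ∈ Finset.univ.erase j, (lam j - lam l)
      = if j = i then ∑ l ∈ Finset.univ.erase i, 1 / (lam i - lam l)
        else 1 / (lam j - lam i) := by
  have hne : ∀ {a b : Fin g}, a ≠ b → lam a - lam b ≠ 0 := fun h => sub_ne_zero.2 (hl.ne h)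
  rw [derivative_prod_finset, eval_finsetSum]
  simp only [derivative_X_sub_C, mul_one, eval_prod, eval_sub, eval_X, eval_C]
  split_ifs with h
  · subst h
    rw [Finset.sum_div]
    refine Finset.sum_congr rfl fun l hl' => ?_
    have h1 : ∏ x ∈ (Finset.univ.erase j).erase l, (lam j - lam x) ≠ 0 :=
      Finset.prod_ne_zero_iff.2 fun x hx => hne (by simp at hx; tauto)
    have h2 := hne (Finset.ne_of_mem_erase hl').symm
    rw [← Finset.mul_prod_erase _ _ hl']
    field_simp
  · rw [Finset.sum_eq_single j]
    · have h1 : ∏ x ∈ (Finset.univ.erase j).erase i, (lam j - lam x) ≠ 0 :=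
        Finset.prod_ne_zero_iff.2 fun x hx => hne (by simp at hx; tauto)
      have h2 := hne h
      have h3 : i ∈ Finset.univ.erase j := by simp [Ne.symm h]
      rw [← Finset.mul_prod_erase _ _ h3, Finset.erase_right_comm]
      field_simp
    · intro b hb hbj
      exact Finset.prod_eq_zero (i := j) (by simp [h, Ne.symm hbj]) (sub_self _)
    · intro hj
      simp [h] at hj

theorem HInf_eq {s : Fin g → ℂ} {t : ℕ → ℂ} (hP : P2 g t = -casimir g s) (mu : Fin g → ℂ)
    (hl : Function.Injective lam) (n : Fin g) :
    HInf g t lam mu n = (spectralPoly g s lam mu).coeff n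
      - ∑ j, mu j * (derivative (divX^[n + 1] (beta g lam))).eval (lam j)
          / ∏ i ∈ Finset.univ.erase j, (lam j - lam i) := by
  set r := Lagrange.interpolate Finset.univ lam (fun j => mu j ^ 2 - (casimir g s).eval (lam j))
    with hr
  have hrdeg : r.natDegree < g := by
    rcases eq_or_ne r 0 with h | h
    · simpa [h] using n.pos
    · exact (natDegree_lt_iff_degree_lt h).2 (degree_interpolate_lt_genus hl _)
  set v : Fin g → ℂ := fun n => (spectralPoly g s lam mu).coeff n
      - ∑ j, mu j * (derivative (divX^[n + 1] (beta g lam))).eval (lam j)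
          / ∏ i ∈ Finset.univ.erase j, (lam j - lam i) with hv
  have hunit : IsUnit (Matrix.vandermonde lam).det :=
    isUnit_iff_ne_zero.2 (Matrix.det_vandermonde_ne_zero_iff.2 hl)
  -- The Vandermonde matrix is invertible, so it suffices to verify the candidate `v`: its first
  -- part interpolates `μ² - Ĩ₀`, its second part yields the interaction terms.
  suffices h : (Matrix.vandermonde lam).mulVec v = hamRhs g t lam mu by
    rw [HInf, ← h, Matrix.mulVec_mulVec, Matrix.nonsing_inv_mul _ hunit, Matrix.one_mulVec]
  funext i
  have h1 : ∑ n : Fin g, lam i ^ (n : ℕ) * (spectralPoly g s lam mu).coeff n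
      = mu i ^ 2 - (casimir g s).eval (lam i) := by
    have := eval_interpolate_node hl (fun j => mu j ^ 2 - (casimir g s).eval (lam j)) i
    rw [← this, ← hr, eval_eq_sum_range' hrdeg, Finset.sum_range]
    refine Finset.sum_congr rfl fun n _ => ?_
    rw [spectralPoly, coeff_add, coeff_casimir_of_lt g s n.2, zero_add, mul_comm]
  have h2 : ∑ n : Fin g, lam i ^ (n : ℕ) *
        ∑ j, mu j * (derivative (divX^[n + 1] (beta g lam))).eval (lam j)
          / ∏ i ∈ Finset.univ.erase j, (lam j - lam i)
      = ∑ j, mu j * (if j = i then ∑ l ∈ Finset.univ.erase i, 1 / (lam i - lam l)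
        else 1 / (lam j - lam i)) := by
    simp only [← eval_derivative_prod_erase hl, ← sum_divX_beta]
    simp only [Finset.mul_sum]
    rw [Finset.sum_comm]
    refine Finset.sum_congr rfl fun j _ => ?_
    rw [Finset.sum_range]
    simp only [derivative_sum, eval_finsetSum, Finset.sum_div, Finset.mul_sum, derivative_C_mul,
      eval_C_mul]
    refine Finset.sum_congr rfl fun n _ => ?_
    ring
  have h3 : ∑ j, mu j * (if j = i then ∑ l ∈ Finset.univ.erase i, 1 / (lam i - lam l)
        else 1 / (lam j - lam i))
      = -∑ j ∈ Finset.univ.erase i, (mu j - mu i) / (lam i - lam j) := by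
    rw [← Finset.add_sum_erase _ _ (Finset.mem_univ i), if_pos rfl, Finset.mul_sum,
      ← Finset.sum_add_distrib, ← Finset.sum_neg_distrib]
    refine Finset.sum_congr rfl fun j hj => ?_
    have hj' := Finset.ne_of_mem_erase hj
    have e1 := sub_ne_zero.2 (hl.ne hj')
    have e2 := sub_ne_zero.2 (hl.ne hj'.symm)
    rw [if_neg hj']
    field_simp
    ring
  simp only [Matrix.mulVec, dotProduct, Matrix.vandermonde_apply, hv, mul_sub,
    Finset.sum_sub_distrib]
  rw [h1, h2, h3, hamRhs, hP, eval_neg]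
  ring

end Lax

/-! ### Identification of the Hamiltonians -/

theorem Ham_eq_K_add_f {g : ℕ} [NeZero g] {s : Fin g → ℂ} {t : ℕ → ℂ}
    (ht : CanonicalTrivialTimes g t)
    (hts : ∀ l : Fin g, t (2 * (l : ℕ) + 1) = (2 * (l : ℂ) + 1) * s l) (k : Fin g)
    {lam : Fin g → ℂ} (mu : Fin g → ℂ) (hl : Function.Injective lam) :
    (2 * (k : ℂ) + 1) * Ham g t (direction (2 * (k : ℕ) + 1)) lam mu
      = K g s lam mu k + f g s k := by
  have hH := Cmat_mulVec_spectralHamiltonian g s (laxMatrix g s lam mu) fun n hn => by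
    rw [neg_det_laxMatrix s mu hl, coeff_spectralPoly s mu hl hn]
  rw [neg_det_laxMatrix s mu hl] at hH
  have hH2 := congrFun (congrArg (Cmat g s)⁻¹.mulVec hH) k
  rw [Matrix.mulVec_add, Matrix.mulVec_mulVec, Matrix.nonsing_inv_mul _ (Cmat_isUnit_det g s),
    Matrix.one_mulVec, Pi.add_apply] at hH2
  have hHam : (2 * (k : ℂ) + 1) * Ham g t (direction (2 * (k : ℕ) + 1)) lam mu
      = ∑ m : Fin g, (Cmat g s)⁻¹ k m * HInf g t lam mu m.rev := by
    rw [Ham, Finset.mul_sum, ← Equiv.sum_comp Fin.revPerm]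
    refine Finset.sum_congr rfl fun m _ => ?_
    rw [← mul_assoc, Fin.revPerm_apply, mul_nu_direction ht hts, Fin.rev_rev]
  have hR : ∑ j, mu j * (derivative (Rtilde g s lam k)).eval (lam j)
        / ∏ i ∈ Finset.univ.erase j, (lam j - lam i)
      = ∑ m : Fin g, (Cmat g s)⁻¹ k m *
        ∑ j, mu j * (derivative (betaTrunc g lam m)).eval (lam j)
          / ∏ i ∈ Finset.univ.erase j, (lam j - lam i) := by
    simp only [Rtilde, derivative_sum, eval_finsetSum, derivative_C_mul, eval_C_mul,
      Finset.mul_sum, Finset.sum_div]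
    rw [Finset.sum_comm]
    refine Finset.sum_congr rfl fun m _ => Finset.sum_congr rfl fun j _ => ?_
    ring
  rw [K, correctedHamiltonian, hR, f, sub_add_eq_add_sub, hH2, hHam, Matrix.mulVec, dotProduct,
    ← Finset.sum_sub_distrib]
  refine Finset.sum_congr rfl fun m _ => ?_
  have hm : ((m.rev : Fin g) : ℕ) = g - 1 - m := by
    rw [Fin.val_rev]
    omega
  -- The reversal matches the truncation `divX^[g - m]` in `betaTrunc` with the one in `HInf` at
  -- `m.rev`.
  have hm2 : ((m.rev : Fin g) : ℕ) + 1 = g - m := by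
    have := m.2
    omega
  rw [HInf_eq (P2_eq_neg_casimir ht hts) mu hl, hm2, hm, mul_sub]
  simp only [betaTrunc]

/-! ### Truncated products with the time series -/

theorem coeff_posPart (a : ℕ → ℂ) (n m : ℕ) :
    (posPart a n).coeff m = if m ≤ n then a (n - m) else 0 := by
  simp only [posPart, finsetSum_coeff, coeff_C_mul, coeff_X_pow]
  split_ifs with h
  · rw [Finset.sum_eq_single (n - m)]
    · rw [if_pos (by omega), mul_one]
    · intro b hb hbm
      simp at hb
      rw [if_neg (by omega), mul_zero]
    · intro hb
      simp at hb
  · refine Finset.sum_eq_zero fun b hb => ?_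
    rw [if_neg (by omega), mul_zero]

/-- The polynomial `∑ₙ c_{2(g+1-N+n)-1} [λⁿ a]_{∞,+}`, `n ≤ N`, for the series `a = ∑ aₖ λ^{-k}`. -/
noncomputable def timePolyPart (g : ℕ) (s : Fin g → ℂ) (N : ℕ) (a : ℕ → ℂ) : ℂ[X] :=
  ∑ n ∈ Finset.range (N + 1), C (c g s (g + 1 - N + n)) * posPart a n

theorem coeff_timePolyPart (g : ℕ) (s : Fin g → ℂ) (N : ℕ) (a : ℕ → ℂ) (m : ℕ) :
    (timePolyPart g s N a).coeff m = ∑ n ∈ Finset.range (N + 1),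
      if m ≤ n then c g s (g + 1 - N + n) * a (n - m) else 0 := by
  simp only [timePolyPart, finsetSum_coeff, coeff_C_mul, coeff_posPart, mul_ite, mul_zero]

theorem natDegree_timePolyPart_le (g : ℕ) (s : Fin g → ℂ) (N : ℕ) (a : ℕ → ℂ) :
    (timePolyPart g s N a).natDegree ≤ N := by
  rw [natDegree_le_iff_coeff_eq_zero]
  intro m hm
  rw [coeff_timePolyPart]
  refine Finset.sum_eq_zero fun n hn => ?_
  simp at hn
  rw [if_neg (by omega)]

theorem coeff_timePolyPart_sub (g : ℕ) (s : Fin g → ℂ) {N e : ℕ} (hN : N ≤ g + 1) (he : e ≤ N)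
    (a : ℕ → ℂ) : (timePolyPart g s N a).coeff (N - e)
      = PowerSeries.coeff e (timeSeries g s * PowerSeries.mk a) := by
  rw [coeff_timePolyPart, PowerSeries.coeff_mul,
    Finset.Nat.sum_antidiagonal_eq_sum_range_succ_mk]
  symm
  refine Finset.sum_of_injOn (fun i => N - i) ?_ ?_ ?_ ?_
  · intro i hi j hj hij
    simp at *
    omega
  · intro i hi
    simp at *
  · intro n hn hn'
    simp only [Finset.mem_range, Finset.coe_range, Set.mem_image, Set.mem_Iio, not_exists,
      not_and] at hn hn'
    have := hn' (N - n)
    rw [if_neg (by omega)]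
  · intro i hi
    simp only [Finset.mem_range] at hi
    simp only
    rw [coeff_timeSeries_of_le g s (by omega), PowerSeries.coeff_mk, if_pos (by omega)]
    congr 2 <;> omega

theorem coeff_coe_reflect_timePolyPart (g : ℕ) (s : Fin g → ℂ) {N e : ℕ} (hN : N ≤ g + 1)
    (he : e ≤ N) (a : ℕ → ℂ) :
    PowerSeries.coeff e ((reflect N (timePolyPart g s N a) : ℂ[X]) : PowerSeries ℂ)
      = PowerSeries.coeff e (timeSeries g s * PowerSeries.mk a) := by
  rw [Polynomial.coeff_coe, coeff_reflect, revAt_le he, coeff_timePolyPart_sub g s hN he]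

theorem exists_reflect_timePolyPart (g : ℕ) (s : Fin g → ℂ) {N : ℕ} (hN : N ≤ g + 1)
    (a : ℕ → ℂ) : ∃ q : PowerSeries ℂ,
      ((reflect N (timePolyPart g s N a) : ℂ[X]) : PowerSeries ℂ)
        = timeSeries g s * PowerSeries.mk a + PowerSeries.X ^ (N + 1) * q := by
  have h : PowerSeries.X ^ (N + 1) ∣ ((reflect N (timePolyPart g s N a) : ℂ[X]) : PowerSeries ℂ)
      - timeSeries g s * PowerSeries.mk a := by
    rw [PowerSeries.X_pow_dvd_iff]
    intro m hm
    rw [map_sub, coeff_coe_reflect_timePolyPart g s hN (by omega), sub_self]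
  obtain ⟨q, hq⟩ := h
  exact ⟨q, by rw [← hq]; ring⟩

/-- The reversed polynomial has degree at most `g`, so its coefficient of order `g + 1` is zero; the
vanishing residue thus gains one order of agreement. -/
theorem exists_reflect_timePolyPart_of_coeff_eq_zero (g : ℕ) (s : Fin g → ℂ)
    (a : ℕ → ℂ) (ha : PowerSeries.coeff (g + 1) (timeSeries g s * PowerSeries.mk a) = 0) :
    ∃ q : PowerSeries ℂ, ((reflect g (timePolyPart g s g a) : ℂ[X]) : PowerSeries ℂ)
        = timeSeries g s * PowerSeries.mk a + PowerSeries.X ^ (g + 2) * q := by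
  have h : PowerSeries.X ^ (g + 2) ∣ ((reflect g (timePolyPart g s g a) : ℂ[X]) : PowerSeries ℂ)
      - timeSeries g s * PowerSeries.mk a := by
    rw [PowerSeries.X_pow_dvd_iff]
    intro m hm
    rw [map_sub]
    rcases Nat.lt_or_ge g m with h | h
    · obtain rfl : m = g + 1 := by omega
      rw [ha, sub_zero, Polynomial.coeff_coe, coeff_reflect, revAt_eq_self_of_lt h]
      exact coeff_eq_zero_of_natDegree_lt ((natDegree_timePolyPart_le _ _ _ _).trans_lt h)
    · rw [coeff_coe_reflect_timePolyPart g s (by omega) h, sub_self]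
  obtain ⟨q, hq⟩ := h
  exact ⟨q, by rw [← hq]; ring⟩

/-- If `A² + BD = λ`, with `D = λ (1 + …)`, and the residue of the `(1,2)` entry vanishes, the
determinant of the truncated matrix has the leading coefficients prescribed by the times. -/
theorem coeff_sq_add_mul_timePolyPart (g : ℕ) (s : Fin g → ℂ) (a b d : ℕ → ℂ)
    (h : PowerSeries.X * PowerSeries.mk a ^ 2 + PowerSeries.mk b * PowerSeries.mk d = 1)
    (hb : PowerSeries.coeff (g + 1) (timeSeries g s * PowerSeries.mk b) = 0)
    {n : ℕ} (hn : n ≤ g + 1) :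
    (timePolyPart g s g a ^ 2 + timePolyPart g s g b * timePolyPart g s (g + 1) d).coeff
        (2 * g + 1 - n)
      = PowerSeries.coeff n (timeSeries g s ^ 2) := by
  obtain ⟨x, hx⟩ := exists_reflect_timePolyPart g s (Nat.le_succ g) a
  obtain ⟨y, hy⟩ := exists_reflect_timePolyPart_of_coeff_eq_zero g s b hb
  obtain ⟨z, hz⟩ := exists_reflect_timePolyPart g s (le_refl (g + 1)) d
  have da := natDegree_timePolyPart_le g s g a
  have db := natDegree_timePolyPart_le g s g b
  have dd := natDegree_timePolyPart_le g s (g + 1) d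
  -- Reversal is taken in degree `2g + 1` although the square has degree at most `2g`; the extra
  -- factor `X` lifts its error from order `g + 1` to `g + 2`.
  have hr1 : reflect (2 * g + 1) (timePolyPart g s g a ^ 2)
      = X * reflect g (timePolyPart g s g a) ^ 2 := by
    have e1 : reflect 1 (1 : ℂ[X]) = X := by simp
    have e2 := reflect_mul (1 : ℂ[X]) (timePolyPart g s g a * timePolyPart g s g a)
      (F := 1) (G := g + g) (by simp) (natDegree_mul_le_of_le da da)
    rw [reflect_mul _ _ da da, e1, one_mul, ← sq, ← sq] at e2
    rw [← e2]
    congr 1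
    omega
  have hr2 : reflect (2 * g + 1) (timePolyPart g s g b * timePolyPart g s (g + 1) d)
      = reflect g (timePolyPart g s g b) * reflect (g + 1) (timePolyPart g s (g + 1) d) := by
    rw [← reflect_mul _ _ db dd]
    congr 1
    omega
  have hfull : ((reflect (2 * g + 1) (timePolyPart g s g a ^ 2
        + timePolyPart g s g b * timePolyPart g s (g + 1) d) : ℂ[X]) : PowerSeries ℂ)
      = timeSeries g s ^ 2 + PowerSeries.X ^ (g + 2) *
        (2 * timeSeries g s * PowerSeries.mk a * x + PowerSeries.X ^ (g + 1) * x ^ 2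
          + timeSeries g s * PowerSeries.mk b * z + timeSeries g s * PowerSeries.mk d * y
          + PowerSeries.X ^ (g + 2) * y * z) := by
    rw [reflect_add, hr1, hr2]
    push_cast
    rw [hx, hy, hz]
    linear_combination (timeSeries g s ^ 2) * h
  have h1 := congrArg (PowerSeries.coeff n) hfull
  rw [Polynomial.coeff_coe, coeff_reflect, revAt_le (by omega), map_add,
    PowerSeries.coeff_X_pow_mul', if_neg (by omega), add_zero] at h1
  exact h1

theorem timePolyPart_genus (g : ℕ) (s : Fin g → ℂ) (a : ℕ → ℂ) :
    timePolyPart g s g a = ∑ n ∈ Finset.range (g + 1), C (c g s (n + 1)) * posPart a n := by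
  simp only [timePolyPart, Nat.add_sub_cancel_left, add_comm 1]

/-! ### The Lax matrix of a solution of the hierarchy -/

section Solution

variable {g : ℕ} [NeZero g] (u : (Fin g → ℂ) → ℂ) (s : Fin g → ℂ)

theorem evalAt_X_zero : evalAt g u s (MvPolynomial.X 0) = u s := by
  simp [evalAt]

theorem evalAt_R_zero : evalAt g u s (R 0) = 1 := by
  rw [R, evalAt, map_one]

theorem evalAt_R_succ (l : ℕ) :
    evalAt g u s (R (l + 1)) =
      -(1 / 8) * ∑ i ∈ Finset.range (l + 1),
          evalAt g u s (dx (R i)) * evalAt g u s (dx (R (l - i)))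
      + 1 / 2 * u s * ∑ i ∈ Finset.range (l + 1), evalAt g u s (R i) * evalAt g u s (R (l - i))
      + 1 / 4 * ∑ i ∈ Finset.range (l + 1),
          evalAt g u s (R (l - i)) * evalAt g u s (dx (dx (R i)))
      - 1 / 2 * ∑ i ∈ Finset.range l, evalAt g u s (R (i + 1)) * evalAt g u s (R (l - i)) := by
  rw [R, ← evalAt_X_zero u s]
  simp only [evalAt, map_add, map_sub, map_mul, map_neg, map_sum, MvPolynomial.aeval_C,
    Finset.sum_range, Algebra.algebraMap_self, RingHom.id_apply]

/-- The coefficients of `λ⁻¹ D`, where `D = -∂ₓ²B/2 + (λ - u) B`. -/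
noncomputable def lowerCoeff : ℕ → ℂ
  | 0 => 1
  | k + 1 => evalAt g u s (R (k + 1)) - u s * evalAt g u s (R k)
      - 1 / 2 * evalAt g u s (dx (dx (R k)))

/-- The identity `A² + BD = λ`, in the variable `w = 1/λ`. -/
theorem resolvent_identity :
    PowerSeries.X * PowerSeries.mk (fun k => -(1 / 2) * evalAt g u s (dx (R k))) ^ 2
      + PowerSeries.mk (fun k => evalAt g u s (R k)) * PowerSeries.mk (lowerCoeff u s) = 1 := by
  ext n
  rw [map_add, mul_comm (PowerSeries.mk fun k => evalAt g u s (R k)),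
    PowerSeries.coeff_mul n (PowerSeries.mk (lowerCoeff u s)),
    Finset.Nat.sum_antidiagonal_eq_sum_range_succ_mk]
  simp only [PowerSeries.coeff_mk]
  rcases n with _ | l
  · simp [lowerCoeff, evalAt_R_zero]
  · rw [PowerSeries.coeff_succ_X_mul, sq, PowerSeries.coeff_mul,
      Finset.Nat.sum_antidiagonal_eq_sum_range_succ_mk, Finset.sum_range_succ' _ (l + 1)]
    simp only [PowerSeries.coeff_mk, lowerCoeff, Nat.add_sub_add_right, Nat.sub_zero, one_mul,
      sub_mul, Finset.sum_sub_distrib]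
    -- The unknown `R (l + 1)` occurs twice, in the first and the last term of the convolution;
    -- hence the factor `2` in front of the recursion at the end.
    rw [Finset.sum_range_succ (fun i => evalAt g u s (R (i + 1)) * evalAt g u s (R (l - i))),
      Nat.sub_self, evalAt_R_zero, mul_one, PowerSeries.coeff_one, if_neg (Nat.succ_ne_zero l)]
    have e1 : ∑ i ∈ Finset.range (l + 1), -(1 / 2) * evalAt g u s (dx (R i))
          * (-(1 / 2) * evalAt g u s (dx (R (l - i))))
        = 1 / 4 * ∑ i ∈ Finset.range (l + 1),
          evalAt g u s (dx (R i)) * evalAt g u s (dx (R (l - i))) := by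
      rw [Finset.mul_sum]
      exact Finset.sum_congr rfl fun i _ => by ring
    have e2 : ∑ i ∈ Finset.range (l + 1), u s * evalAt g u s (R i) * evalAt g u s (R (l - i))
        = u s * ∑ i ∈ Finset.range (l + 1), evalAt g u s (R i) * evalAt g u s (R (l - i)) := by
      rw [Finset.mul_sum]
      exact Finset.sum_congr rfl fun i _ => by ring
    have e3 : ∑ i ∈ Finset.range (l + 1),
          1 / 2 * evalAt g u s (dx (dx (R i))) * evalAt g u s (R (l - i))
        = 1 / 2 * ∑ i ∈ Finset.range (l + 1),
          evalAt g u s (R (l - i)) * evalAt g u s (dx (dx (R i))) := by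
      rw [Finset.mul_sum]
      exact Finset.sum_congr rfl fun i _ => by ring
    rw [e1, e2, e3]
    linear_combination 2 * evalAt_R_succ u s l

variable {u s}

theorem sum_c_mul_evalAt_R {Ω : Set (Fin g → ℂ)} (hu : IsPISolution g Ω u) (hs : s ∈ Ω) :
    ∑ l ∈ Finset.range (g + 2), c g s l * evalAt g u s (R l) = 0 := by
  rw [Finset.sum_range_succ, Finset.sum_range_succ, c_top, c_genus, zero_mul, one_mul, add_zero,
    add_comm, Finset.sum_range, ← hu.string_eq s hs]
  refine congrArg _ (Finset.sum_congr rfl fun l _ => ?_)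
  rw [c_of_lt s l.2]

theorem coeff_timeSeries_mul_R {Ω : Set (Fin g → ℂ)} (hu : IsPISolution g Ω u) (hs : s ∈ Ω) :
    PowerSeries.coeff (g + 1)
      (timeSeries g s * PowerSeries.mk fun k => evalAt g u s (R k)) = 0 := by
  rw [PowerSeries.coeff_mul, Finset.Nat.sum_antidiagonal_eq_sum_range_succ_mk,
    ← sum_c_mul_evalAt_R hu hs, ← Finset.sum_range_reflect _ (g + 2)]
  refine Finset.sum_congr rfl fun i hi => ?_
  simp only [Finset.mem_range] at hi
  rw [coeff_timeSeries_of_le g s (by omega), PowerSeries.coeff_mk]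
  congr 2 <;> congr 1 <;> omega

theorem laxMatrixU_apply (i j : Fin 2) :
    laxMatrixU g u s i j
      = ∑ n ∈ Finset.range (g + 1), C (c g s (n + 1)) * Umat g u s n i j := by
  simp only [laxMatrixU, Matrix.sum_apply, Matrix.smul_apply, smul_eq_mul]

theorem laxMatrixU_zero_zero :
    laxMatrixU g u s 0 0
      = timePolyPart g s g (fun k => -(1 / 2) * evalAt g u s (dx (R k))) := by
  rw [laxMatrixU_apply, timePolyPart_genus]
  rfl

theorem laxMatrixU_zero_one :
    laxMatrixU g u s 0 1 = timePolyPart g s g (fun k => evalAt g u s (R k)) := by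
  rw [laxMatrixU_apply, timePolyPart_genus]
  rfl

theorem laxMatrixU_one_one : laxMatrixU g u s 1 1 = -laxMatrixU g u s 0 0 := by
  rw [laxMatrixU_apply, laxMatrixU_apply, ← Finset.sum_neg_distrib]
  refine Finset.sum_congr rfl fun n _ => ?_
  rw [← mul_neg]
  rfl

theorem Umat_one_zero (n : ℕ) :
    Umat g u s n 1 0 = posPart (lowerCoeff u s) (n + 1) - C (evalAt g u s (R (n + 1))) := by
  have h : posPart (lowerCoeff u s) (n + 1) = X ^ (n + 1)
      + posPart (fun k => lowerCoeff u s (k + 1)) n := by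
    rw [posPart, Finset.sum_range_succ', add_comm, posPart]
    simp [lowerCoeff]
  rw [h]
  rfl

/-- By the string equation the subtracted terms `c_{2n+1} R_{2n+1}` sum to `-c_{-1}`, which supplies
the missing lowest term `n = 0` of the truncation. -/
theorem laxMatrixU_one_zero {Ω : Set (Fin g → ℂ)} (hu : IsPISolution g Ω u) (hs : s ∈ Ω) :
    laxMatrixU g u s 1 0 = timePolyPart g s (g + 1) (lowerCoeff u s) := by
  have hst := congrArg (C (R := ℂ)) (sum_c_mul_evalAt_R hu hs)
  rw [Finset.sum_range_succ', evalAt_R_zero, mul_one, map_add, map_sum, map_zero] at hst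
  have h0 : posPart (lowerCoeff u s) 0 = 1 := by simp [posPart, lowerCoeff]
  rw [laxMatrixU_apply, timePolyPart, Finset.sum_range_succ' _ (g + 1)]
  simp only [Umat_one_zero, mul_sub, Finset.sum_sub_distrib, Nat.sub_self, zero_add, h0, mul_one]
  simp only [map_mul] at hst
  linear_combination -hst

theorem neg_det_laxMatrixU {Ω : Set (Fin g → ℂ)} (hu : IsPISolution g Ω u) (hs : s ∈ Ω)
    {lam mu : Fin g → ℂ} (h : IsSpectralCoord g (laxMatrixU g u s) lam mu) :
    -(laxMatrixU g u s).det = spectralPoly g s lam mu := by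
  have hdet : -(laxMatrixU g u s).det
      = laxMatrixU g u s 0 0 ^ 2 + laxMatrixU g u s 0 1 * laxMatrixU g u s 1 0 := by
    rw [Matrix.det_fin_two, laxMatrixU_one_one]
    ring
  rw [hdet]
  -- The coefficients in degrees `≥ g` are fixed by the times; the remaining `g` by the values `μⱼ²`
  -- at the `g` distinct points `λⱼ`.
  refine Polynomial.eq_of_degree_sub_lt_of_eval_index_eq Finset.univ h.distinct.injOn ?_ ?_
  · rw [Finset.card_univ, Fintype.card_fin, degree_lt_iff_coeff_zero]
    intro m hm
    rw [coeff_sub, sub_eq_zero, laxMatrixU_zero_zero, laxMatrixU_zero_one,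
      laxMatrixU_one_zero hu hs]
    rcases Nat.lt_or_ge (2 * g + 1) m with hm' | hm'
    · rw [coeff_eq_zero_of_natDegree_lt, coeff_eq_zero_of_natDegree_lt]
      · refine lt_of_le_of_lt (natDegree_add_le_of_degree_le (natDegree_casimir_le g s) ?_) hm'
        exact natDegree_le_of_degree_le ((degree_interpolate_lt_genus h.distinct _).le.trans
          (by exact_mod_cast (by omega : g ≤ 2 * g + 1)))
      · refine lt_of_le_of_lt (natDegree_add_le_of_degree_le ?_ ?_) hm'
        · exact (natDegree_pow_le_of_le 2 (natDegree_timePolyPart_le g s g _)).trans (by omega)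
        · exact (natDegree_mul_le_of_le (natDegree_timePolyPart_le g s g _)
            (natDegree_timePolyPart_le g s (g + 1) _)).trans (by omega)
    · have := coeff_sq_add_mul_timePolyPart g s _ _ _ (resolvent_identity u s)
        (coeff_timeSeries_mul_R hu hs) (n := 2 * g + 1 - m) (by omega)
      rw [← coeff_spectralPoly (lam := lam) s mu h.distinct (by omega)] at this
      rwa [show 2 * g + 1 - (2 * g + 1 - m) = m by omega] at this
  · intro j _
    rw [eval_add, eval_mul, h.zero, zero_mul, add_zero, eval_pow, h.value,
      eval_spectralPoly s mu h.distinct]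

theorem beta_eq_timePolyPart {lam mu : Fin g → ℂ}
    (h : IsSpectralCoord g (laxMatrixU g u s) lam mu) :
    beta g lam = timePolyPart g s g (fun k => evalAt g u s (R k)) := by
  refine Polynomial.eq_of_degree_sub_lt_of_eval_index_eq Finset.univ h.distinct.injOn ?_ ?_
  · rw [Finset.card_univ, Fintype.card_fin, degree_lt_iff_coeff_zero]
    intro m hm
    rw [coeff_sub, sub_eq_zero]
    rcases hm.lt_or_eq with hm' | rfl
    · rw [coeff_eq_zero_of_natDegree_lt (by rwa [natDegree_beta]),
        coeff_eq_zero_of_natDegree_lt ((natDegree_timePolyPart_le _ _ _ _).trans_lt hm')]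
    · have h1 := (monic_beta g lam).coeff_natDegree
      have h2 := coeff_timePolyPart_sub g s (Nat.le_succ g) (Nat.zero_le g)
        (fun k => evalAt g u s (R k))
      rw [natDegree_beta] at h1
      rw [h1]
      rw [Nat.sub_zero, PowerSeries.coeff_zero_eq_constantCoeff_apply, map_mul,
        constantCoeff_timeSeries, one_mul, ← PowerSeries.coeff_zero_eq_constantCoeff_apply,
        PowerSeries.coeff_mk, evalAt_R_zero] at h2
      exact h2.symm
  · intro j _
    rw [eval_beta, ← laxMatrixU_zero_one, h.zero]

/-- Dropping the lowest `g - n` coefficients of `β` shifts the summation index by `g - n`, because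
the `R` in each term depends only on the difference of the indices. -/
theorem betaTrunc_eq {lam mu : Fin g → ℂ}
    (h : IsSpectralCoord g (laxMatrixU g u s) lam mu) (n : Fin g) :
    betaTrunc g lam n = ∑ l : Fin g, C (Cmat g s n l) * RtildeU g u s l := by
  ext m
  have hn := n.2
  simp only [betaTrunc, coeff_iterate_divX, beta_eq_timePolyPart h, coeff_timePolyPart,
    finsetSum_coeff, coeff_C_mul, RtildeU, coeff_posPart]
  have h1 : ∑ l : Fin g, Cmat g s n l
        * (if m ≤ (l : ℕ) then evalAt g u s (R ((l : ℕ) - m)) else 0)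
      = ∑ l ∈ Finset.range (n + 1), c g s (g + 1 - (n - l))
        * (if m ≤ l then evalAt g u s (R (l - m)) else 0) := by
    rw [Finset.sum_fin_eq_sum_range]
    symm
    refine Finset.sum_subset_zero_on_sdiff (by simp) ?_ ?_
    · intro l hl
      simp only [Finset.mem_sdiff, Finset.mem_range] at hl
      rw [dif_pos hl.1, Cmat, if_pos (by rw [Fin.lt_def]; simp only; omega), zero_mul]
    · intro l hl
      simp only [Finset.mem_range] at hl
      have hnl : ¬n < ⟨l, by omega⟩ := by
        rw [Fin.lt_def]
        simp only
        omega
      rw [dif_pos (by omega), Cmat, if_neg hnl]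
  rw [h1]
  symm
  refine Finset.sum_of_injOn (fun l => l + (g - n)) ?_ ?_ ?_ ?_
  · intro i hi j hj hij
    simpa using hij
  · intro i hi
    simp at *
    omega
  · intro i hi hi'
    simp only [Finset.mem_range, Finset.coe_range, Set.mem_image, Set.mem_Iio, not_exists,
      not_and] at hi hi'
    have := hi' (i - (g - n))
    rw [if_neg (by omega)]
  · intro l hl
    simp only [Finset.mem_range] at hl
    by_cases hml : m ≤ l
    · rw [if_pos hml, if_pos (by omega), show g + 1 - g + (l + (g - n)) = g + 1 - (n - l) by omega,
        show l + (g - n) - (m + (g - n)) = l - m by omega]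
    · rw [if_neg hml, if_neg (by omega), mul_zero]

theorem Rtilde_eq_RtildeU {lam mu : Fin g → ℂ}
    (h : IsSpectralCoord g (laxMatrixU g u s) lam mu) (n : Fin g) :
    Rtilde g s lam n = RtildeU g u s n := by
  simp only [Rtilde, betaTrunc_eq h, Finset.mul_sum]
  rw [Finset.sum_comm]
  simp only [← mul_assoc, ← map_mul]
  simp only [← Finset.sum_mul, ← map_sum, ← Matrix.mul_apply,
    Matrix.nonsing_inv_mul _ (Cmat_isUnit_det g s), Matrix.one_apply]
  simp

end Solution

end PainleveI

theorem mainTheorem1 (g : ℕ) [NeZero g] (s : Fin g → ℂ) (t : ℕ → ℂ)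
    (ht : PainleveI.CanonicalTrivialTimes g t)
    (hts : ∀ l : Fin g, t (2 * (l : ℕ) + 1) = (2 * (l : ℂ) + 1) * s l) (k : Fin g) :
    (∀ lam mu : Fin g → ℂ, Function.Injective lam →
      (2 * (k : ℂ) + 1) * PainleveI.Ham g t (PainleveI.direction (2 * (k : ℕ) + 1)) lam mu
        = PainleveI.K g s lam mu k + PainleveI.f g s k) ∧
    (∀ (Ω : Set (Fin g → ℂ)) (u : (Fin g → ℂ) → ℂ), PainleveI.IsPISolution g Ω u → s ∈ Ω →
      ∀ lam mu : Fin g → ℂ, PainleveI.IsSpectralCoord g (PainleveI.laxMatrixU g u s) lam mu →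
        PainleveI.K g s lam mu k
          = PainleveI.correctedHamiltonian g (PainleveI.laxMatrixU g u s)
              (PainleveI.RtildeU g u s k) lam mu k) := by
  refine ⟨fun lam mu hl => PainleveI.Ham_eq_K_add_f ht hts k mu hl, ?_⟩
  intro Ω u hu hs lam mu h
  -- The spectral Hamiltonians see a Lax matrix only through its determinant, so the two matrices
  -- themselves need not be compared.
  rw [PainleveI.K, PainleveI.correctedHamiltonian, PainleveI.correctedHamiltonian,
    PainleveI.spectralHamiltonian, PainleveI.spectralHamiltonian,
    PainleveI.neg_det_laxMatrix s mu h.distinct, PainleveI.neg_det_laxMatrixU hu hs h,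
    PainleveI.Rtilde_eq_RtildeU h]
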